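/- Let $n,m\in\mathbb N$, let $|\cdot|$ denote fixed (arbitrary) norms on $\mathbb R^n$ and on $\mathbb R^m$, and let $G:\mathbb R^n\times\mathbb R^m\to\mathbb R^n$ be any map, not necessarily continuous. Consider the discrete-time system $$x(k+1)=G(x(k),u(k)),\qquad k\in\mathbb N=\{0,1,2,\dots\},$$ and write $x(k,\xi,u(\cdot))$ for its solution at time $k$ with $x(0)=\xi$ and input $u:\mathbb N\to\mathbb R^m$. For an input $u$ let $\|u\|_\infty:=\sup_{k}|u(k)|$, and write $u\in l^\infty(\mathbb R^m)$ if this is finite. Comparison functions: $\alpha:\mathbb R_+\to\mathbb R_+$ is of class $\mathcal K$ if it is continuous and strictly increasing with $\alpha(0)=0$, and of class $\mathcal K_\infty$ if it is moreover unbounded; $\beta:\mathbb R_+\times\mathbb R_+\to\mathbb R_+$ is of class $\mathcal{KL}$ if $\beta(\cdot,t)\in\mathcal K$ for every $t\ge 0$ and, for every $s>0$, $\beta(s,\cdot)$ is continuous and strictly decreasing with $\lim_{t\to\infty}\beta(s,t)=0$; $\rho:\mathbb R_+\to\mathbb R_+$ is positive definite if it is continuous, $\rho(0)=0$ and $\rho(s)>0$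 for $s>0$. The system is input-to-state stable (ISS) if there are $\beta\in\mathcal{KL}$ and $\gamma\in\mathcal K$ such that for all $\xi\in\mathbb R^n$, all $u\in l^\infty(\mathbb R^m)$ and all $k\in\mathbb N$, $$|x(k,\xi,u(\cdot))|\le\beta(|\xi|,k)+\gamma(\|u\|_\infty).$$ A function $V:\mathbb R^n\to\mathbb R_+$ is a dissipative finite-step ISS Lyapunov function for the system, with step number $M\in\mathbb N$, if there are $\alpha_1,\alpha_2\in\mathcal K_\infty$ with $\alpha_1(|\xi|)\le V(\xi)\le\alpha_2(|\xi|)$ for all $\xi\in\mathbb R^n$, and there are $\sigma\in\mathcal K$ and a positive definite function $\rho$ with $\mathrm{id}-\rho\in\mathcal K_\infty$ such that for all $\xi\in\mathbb R^n$ and all $u\in l^\infty(\mathbb R^m)$, $$V(x(M,\xi,u(\cdot)))\le\rho(V(\xi))+\sigma(\|u\|_\infty).$$ Proposition. If the system is ISS, then there exists a dissipative finite-step ISS Lyapunov function $V$ for it; moreover, $V$ can be chosen to have this property with step number $M=1$. -/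

import Mathlib

open Set Filter Topology

namespace ISSys

/-! Comparison functions. Functions on the half line `[0, ∞)` are represented by functions
`ℝ → ℝ` of which only the restriction to `[0, ∞)` matters. -/

/-- Class `K`: continuous and strictly increasing on `[0, ∞)`, zero at zero. -/
structure ClassK (α : ℝ → ℝ) : Prop where
  continuousOn : ContinuousOn α (Ici 0)
  strictMonoOn : StrictMonoOn α (Ici 0)
  map_zero : α 0 = 0

/-- Class `K∞`: unbounded functions of class `K`. -/
structure ClassKInf (α : ℝ → ℝ) : Prop extends ClassK α where
  tendsto_atTop : Tendsto α atTop atTop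

/-- Class `L`: continuous and strictly decreasing on `[0, ∞)`, with limit zero at infinity
(hence positive on `[0, ∞)`). -/
structure ClassL (φ : ℝ → ℝ) : Prop where
  continuousOn : ContinuousOn φ (Ici 0)
  strictAntiOn : StrictAntiOn φ (Ici 0)
  tendsto_zero : Tendsto φ atTop (𝓝 0)

/-- Class `KL`: `β (·, t)` is of class `K` for all `t ≥ 0`, and `β (s, ·)` is of class `L` for
all `s > 0` (for `s = 0` it is the zero function). -/
structure ClassKL (β : ℝ → ℝ → ℝ) : Prop where
  classK : ∀ t : ℝ, 0 ≤ t → ClassK (fun s => β s t)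
  classL : ∀ s : ℝ, 0 < s → ClassL (fun t => β s t)

/-- A positive definite function on `[0, ∞)`: continuous, zero at zero, positive elsewhere. -/
structure PosDefFun (ρ : ℝ → ℝ) : Prop where
  continuousOn : ContinuousOn ρ (Ici 0)
  map_zero : ρ 0 = 0
  pos : ∀ s : ℝ, 0 < s → 0 < ρ s

/-! Discrete-time systems `x (k + 1) = G (x k, u k)` on `ℝⁿ` with inputs in `ℝᵐ`. -/

/-- The solution `x (k, ξ, u)` at time `k`, with initial state `ξ` and input `u`. -/
def sol {n m : ℕ} (G : (Fin n → ℝ) → (Fin m → ℝ) → (Fin n → ℝ)) (ξ : Fin n → ℝ)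
    (u : ℕ → Fin m → ℝ) : ℕ → Fin n → ℝ
  | 0 => ξ
  | k + 1 => G (sol G ξ u k) (u k)

/-- The input is bounded with respect to `q`, that is, `u` lies in `ℓ^∞`. -/
def BoundedInput {m : ℕ} (q : Seminorm ℝ (Fin m → ℝ)) (u : ℕ → Fin m → ℝ) : Prop :=
  BddAbove (range fun k => q (u k))

/-- The supremum over all times `k` of `q (u k)`; it is used for bounded inputs only. -/
noncomputable def supNorm {m : ℕ} (q : Seminorm ℝ (Fin m → ℝ)) (u : ℕ → Fin m → ℝ) : ℝ :=
  ⨆ k, q (u k)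

/-- Input-to-state stability of `x (k + 1) = G (x k, u k)`, where `p` and `q` are the norms on
the state space and on the input space. -/
def ISS {n m : ℕ} (p : Seminorm ℝ (Fin n → ℝ)) (q : Seminorm ℝ (Fin m → ℝ))
    (G : (Fin n → ℝ) → (Fin m → ℝ) → (Fin n → ℝ)) : Prop :=
  ∃ (β : ℝ → ℝ → ℝ) (γ : ℝ → ℝ), ClassKL β ∧ ClassK γ ∧
    ∀ (ξ : Fin n → ℝ) (u : ℕ → Fin m → ℝ), BoundedInput q u → ∀ k : ℕ,
      p (sol G ξ u k) ≤ β (p ξ) k + γ (supNorm q u)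

/-- Nonnegative functions on the state space that are proper and positive definite. -/
def ProperPosDef {n : ℕ} (p : Seminorm ℝ (Fin n → ℝ)) (V : (Fin n → ℝ) → ℝ) : Prop :=
  (∀ ξ, 0 ≤ V ξ) ∧
    ∃ α₁ α₂ : ℝ → ℝ, ClassKInf α₁ ∧ ClassKInf α₂ ∧ ∀ ξ, α₁ (p ξ) ≤ V ξ ∧ V ξ ≤ α₂ (p ξ)

/-- `V` is a dissipative finite-step ISS Lyapunov function with step number `M`. -/
def IsMStepISSLyapunov {n m : ℕ} (p : Seminorm ℝ (Fin n → ℝ)) (q : Seminorm ℝ (Fin m → ℝ))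
    (G : (Fin n → ℝ) → (Fin m → ℝ) → (Fin n → ℝ)) (M : ℕ) (V : (Fin n → ℝ) → ℝ) : Prop :=
  ProperPosDef p V ∧
    ∃ σ ρ : ℝ → ℝ, ClassK σ ∧ PosDefFun ρ ∧ ClassKInf (fun s => s - ρ s) ∧
      ∀ (ξ : Fin n → ℝ) (u : ℕ → Fin m → ℝ), BoundedInput q u →
        V (sol G ξ u M) ≤ ρ (V ξ) + σ (supNorm q u)

/-- `V` is a dissipative finite-step ISS Lyapunov function. -/
def IsFiniteStepISSLyapunov {n m : ℕ} (p : Seminorm ℝ (Fin n → ℝ))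
    (q : Seminorm ℝ (Fin m → ℝ)) (G : (Fin n → ℝ) → (Fin m → ℝ) → (Fin n → ℝ))
    (V : (Fin n → ℝ) → ℝ) : Prop :=
  ∃ M : ℕ, IsMStepISSLyapunov p q G M V

end ISSys

namespace ISSys

open Real (exp log)

/-! ### Comparison functions and the rescaling `ω` -/

section Comparison

/-! Rescale the state by `ω` in class K∞ growing so fast that the time `T` in which `β` brings `e *
r` below `r / 2` costs at most a factor: `e^T * ω r ≤ ω (e * r)` (`ClassKL.exists_classKInf_fast`).
Then `e^k * ω |x(k)|` stays below the maximum of a function of `|ξ|` and the weighted inputs `e^j *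
χ |u j|`, `j < k` (`exp_mul_sol_le_max`). So the supremum `V ξ` of `e^k * ω |x(k)| - c`, with `c`
dominating those inputs, is finite. Prepending an input `v` multiplies all weights by `e`, whence `e
* V (G ξ v) ≤ V ξ + χ |v|`, a one-step dissipation inequality. -/

theorem ClassK.nonneg {α : ℝ → ℝ} (h : ClassK α) {s : ℝ} (hs : 0 ≤ s) : 0 ≤ α s :=
  h.map_zero ▸ h.strictMonoOn.monotoneOn self_mem_Ici hs hs

theorem ClassK.mono {α : ℝ → ℝ} (h : ClassK α) {s t : ℝ} (hs : 0 ≤ s) (hst : s ≤ t) :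
    α s ≤ α t :=
  h.strictMonoOn.monotoneOn hs (hs.trans hst : (0 : ℝ) ≤ t) hst

theorem ClassK.le_of_map_le {α : ℝ → ℝ} (h : ClassK α) {s t : ℝ} (hs : 0 ≤ s) (ht : 0 ≤ t)
    (hst : α s ≤ α t) : s ≤ t :=
  (h.strictMonoOn.le_iff_le hs ht).1 hst

theorem ClassK.comp {α κ : ℝ → ℝ} (hα : ClassK α) (hκ : ClassK κ) :
    ClassK (fun s => α (κ s)) where
  continuousOn := hα.continuousOn.comp hκ.continuousOn fun _ hs => hκ.nonneg hs
  strictMonoOn := hα.strictMonoOn.comp hκ.strictMonoOn fun _ hs => hκ.nonneg hs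
  map_zero := by rw [hκ.map_zero, hα.map_zero]

theorem ClassK.const_mul {α : ℝ → ℝ} (h : ClassK α) {a : ℝ} (ha : 0 < a) :
    ClassK (fun s => a * α s) where
  continuousOn := h.continuousOn.const_mul a
  strictMonoOn := fun _ hs _ ht hst => mul_lt_mul_of_pos_left (h.strictMonoOn hs ht hst) ha
  map_zero := by rw [h.map_zero, mul_zero]

theorem ClassK.add_id {α : ℝ → ℝ} (h : ClassK α) : ClassK (fun s => α s + s) where
  continuousOn := h.continuousOn.add continuousOn_id
  strictMonoOn := fun _ hs _ ht hst => add_lt_add (h.strictMonoOn hs ht hst) hst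
  map_zero := by rw [h.map_zero, add_zero]

/-- A class K function may be bounded; the added identity makes the upper bound of `V` class K∞. -/
theorem ClassKInf.comp_add_id {α κ : ℝ → ℝ} (hα : ClassKInf α) (hκ : ClassK κ) :
    ClassKInf (fun s => α (κ s + s)) where
  toClassK := hα.toClassK.comp hκ.add_id
  tendsto_atTop := hα.tendsto_atTop.comp <|
    tendsto_atTop_mono' atTop
      ((eventually_ge_atTop 0).mono fun _ hs => le_add_of_nonneg_left (hκ.nonneg hs)) tendsto_id

theorem classKInf_const_mul {a : ℝ} (ha : 0 < a) : ClassKInf (fun s => a * s) where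
  continuousOn := by fun_prop
  strictMonoOn := fun _ _ _ _ hst => mul_lt_mul_of_pos_left hst ha
  map_zero := mul_zero a
  tendsto_atTop := tendsto_id.const_mul_atTop ha

theorem ClassKL.anti {β : ℝ → ℝ → ℝ} (h : ClassKL β) {s t t' : ℝ} (hs : 0 ≤ s) (ht : 0 ≤ t)
    (htt' : t ≤ t') : β s t' ≤ β s t := by
  rcases hs.eq_or_lt with rfl | hs
  · rw [(h.classK t ht).map_zero, (h.classK t' (ht.trans htt')).map_zero]
  · exact (h.classL s hs).strictAntiOn.antitoneOn ht (ht.trans htt' : (0 : ℝ) ≤ t') htt'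

/-- A continuous function on the logarithmic scale that bounds the times needed by `β` for a
reduction by the factor `2e`. -/
theorem ClassKL.exists_continuous_decay_time {β : ℝ → ℝ → ℝ} (h : ClassKL β) :
    ∃ g : C(ℝ, ℝ), ∀ z, 1 ≤ g z ∧ ∀ y ∈ Icc (z - 1) z, ∀ k : ℕ, g z ≤ k + 1 →
      2 * β (exp (y + 1)) k < exp y := by
  -- Admissible values are closed upwards, hence convex, and one constant serves near each `z₀`, so
  -- a partition of unity glues them.
  refine exists_continuous_forall_mem_convex_of_local_const
    (t := fun z => {τ : ℝ | 1 ≤ τ ∧ ∀ y ∈ Icc (z - 1) z, ∀ k : ℕ, τ ≤ k + 1 →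
      2 * β (exp (y + 1)) k < exp y}) (fun z => ?_) (fun z₀ => ?_)
  · refine OrdConnected.convex ⟨fun a ha b _ c hc => ⟨ha.1.trans hc.1, fun y hy k hk => ?_⟩⟩
    exact ha.2 y hy k (hc.1.trans hk)
  · have hlim : Tendsto (fun t => 2 * β (exp (z₀ + 2)) t) atTop (𝓝 (2 * 0)) :=
      ((h.classL _ (Real.exp_pos _)).tendsto_zero).const_mul 2
    rw [mul_zero] at hlim
    obtain ⟨K, hK⟩ := (((hlim.comp tendsto_natCast_atTop_atTop).eventually
      (gt_mem_nhds (Real.exp_pos (z₀ - 2))))).exists_forall_of_atTop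
    refine ⟨K + 1, ?_⟩
    filter_upwards [Ioo_mem_nhds (sub_one_lt z₀) (lt_add_one z₀)] with z hz
    refine ⟨by simp, fun y hy k hk => ?_⟩
    have hKk : K ≤ k := by exact_mod_cast (by linarith : (K : ℝ) ≤ k)
    have h1 := (h.classK k k.cast_nonneg).mono (Real.exp_pos (y + 1)).le
      (Real.exp_le_exp.2 (by linarith [hy.2, hz.2] : y + 1 ≤ z₀ + 2))
    have h2 : 2 * β (exp (z₀ + 2)) k < exp (z₀ - 2) := hK k hKk
    have h3 := Real.exp_le_exp.2 (by linarith [hy.1, hz.1] : z₀ - 2 ≤ y)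
    linarith

/-- An increasing homeomorphism of the line, read on the logarithmic scale on both sides, gives a
function of class `K∞`. -/
theorem classKInf_exp_log {h : ℝ → ℝ} (hc : Continuous h) (hm : StrictMono h)
    (hbot : Tendsto h atBot atBot) (htop : Tendsto h atTop atTop) :
    ClassKInf (fun r => if r ≤ 0 then 0 else exp (h (log r))) where
  continuousOn := by
    intro r hr
    rcases (mem_Ici.1 hr).eq_or_lt with rfl | hr
    · have h0 : Tendsto (fun r => exp (h (log r))) (𝓝[>] 0) (𝓝 0) :=
        Real.tendsto_exp_atBot.comp (hbot.comp Real.tendsto_log_nhdsGT_zero)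
      rw [← continuousWithinAt_Ioi_iff_Ici, ContinuousWithinAt, if_pos le_rfl]
      refine h0.congr' ?_
      filter_upwards [self_mem_nhdsWithin] with r hr
      rw [if_neg (not_le.2 hr)]
    · have h0 : ContinuousAt (fun r => exp (h (log r))) r :=
        (Real.continuous_exp.comp hc).continuousAt.comp (Real.continuousAt_log hr.ne')
      refine (h0.congr ?_).continuousWithinAt
      filter_upwards [Ioi_mem_nhds hr] with r hr
      rw [if_neg (not_le.2 hr)]
  strictMonoOn := by
    intro s hs t _ hst
    have ht : 0 < t := (mem_Ici.1 hs).trans_lt hst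
    simp only [if_neg (not_le.2 ht)]
    split_ifs with hs0
    · exact Real.exp_pos _
    · exact Real.exp_lt_exp.2 (hm (Real.log_lt_log (not_le.1 hs0) hst))
  map_zero := if_pos le_rfl
  tendsto_atTop := by
    refine (Real.tendsto_exp_atTop.comp (htop.comp Real.tendsto_log_atTop)).congr' ?_
    filter_upwards [eventually_gt_atTop 0] with r hr
    simp [not_le.2 hr]

/-- For every `β` of class `KL` there is a function of class `K∞` which grows so fast that it
turns the decay described by `β` into exponential decay. -/
theorem ClassKL.exists_classKInf_fast {β : ℝ → ℝ → ℝ} (hβ : ClassKL β) :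
    ∃ ω : ℝ → ℝ, ClassKInf ω ∧ ∀ r, 0 < r → ∃ T : ℕ,
      2 * β (exp 1 * r) T < r ∧ exp T * ω r ≤ ω (exp 1 * r) := by
  obtain ⟨g, hg⟩ := hβ.exists_continuous_decay_time
  -- With `ω = exp ∘ h ∘ log`, passing from `r` to `e * r` multiplies `ω` by `exp (g z)` for some
  -- `z` between `log r` and `log r + 1`.
  set h : ℝ → ℝ := fun y => ∫ z in (0 : ℝ)..y, g z with hh
  have hd : ∀ y, HasDerivAt h (g y) y := fun y =>
    intervalIntegral.integral_hasDerivAt_right (g.continuous.intervalIntegrable _ _)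
      (g.continuous.stronglyMeasurableAtFilter _ _) g.continuous.continuousAt
  have hc : Continuous h := continuous_iff_continuousAt.2 fun y => (hd y).continuousAt
  have hmvt : ∀ a b, a < b → ∃ z ∈ Ioo a b, g z * (b - a) = h b - h a := by
    intro a b hab
    obtain ⟨z, hz, he⟩ := exists_hasDerivAt_eq_slope h g hab hc.continuousOn fun y _ => hd y
    exact ⟨z, hz, by rw [he, div_mul_cancel₀ _ (sub_pos.2 hab).ne']⟩
  have hgrow : ∀ a b, a < b → b - a ≤ h b - h a := by
    intro a b hab
    obtain ⟨z, -, he⟩ := hmvt a b hab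
    rw [← he]
    exact le_mul_of_one_le_left (sub_pos.2 hab).le (hg z).1
  have h00 : h 0 = 0 := by simp [hh]
  have hm : StrictMono h := fun a b hab => by linarith [hgrow a b hab]
  have htop : Tendsto h atTop atTop := by
    refine tendsto_atTop_mono' atTop ?_ tendsto_id
    filter_upwards [eventually_gt_atTop 0] with y hy
    have := hgrow 0 y hy
    simp only [id]
    linarith
  have hbot : Tendsto h atBot atBot := by
    refine tendsto_atBot_mono' atBot ?_ tendsto_id
    filter_upwards [eventually_lt_atBot 0] with y hy
    have := hgrow y 0 hy
    simp only [id]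
    linarith
  refine ⟨_, classKInf_exp_log hc hm hbot htop, fun r hr => ?_⟩
  obtain ⟨z, hz, he⟩ := hmvt (log r) (log r + 1) (lt_add_one _)
  rw [add_sub_cancel_left, mul_one] at he
  have hr' : exp 1 * r = exp (log r + 1) := by rw [Real.exp_add, Real.exp_log hr, mul_comm]
  have hpos : 0 < exp 1 * r := mul_pos (Real.exp_pos _) hr
  -- `T ≤ g z` gives the growth of `ω`, `g z ≤ T + 1` the decay of `β`.
  refine ⟨⌊g z⌋₊, ?_, ?_⟩
  · have := (hg z).2 (log r) ⟨by linarith [hz.2], hz.1.le⟩ ⌊g z⌋₊ (Nat.lt_floor_add_one _).le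
    rwa [← hr', Real.exp_log hr] at this
  · rw [if_neg (not_le.2 hr), if_neg (not_le.2 hpos), ← Real.exp_add, hr', Real.log_exp,
      Real.exp_le_exp]
    linarith [Nat.floor_le (zero_le_one.trans (hg z).1)]

end Comparison

/-! ### Trajectory estimates -/

section Trajectories

variable {n m : ℕ} {p : Seminorm ℝ (Fin n → ℝ)} {q : Seminorm ℝ (Fin m → ℝ)}
  {G : (Fin n → ℝ) → (Fin m → ℝ) → (Fin n → ℝ)}

theorem sol_add (ξ : Fin n → ℝ) (u : ℕ → Fin m → ℝ) (a b : ℕ) :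
    sol G ξ u (a + b) = sol G (sol G ξ u a) (fun j => u (a + j)) b := by
  induction b with
  | zero => rfl
  | succ b ih => rw [← add_assoc, sol, sol, ih]

theorem sol_congr (ξ : Fin n → ℝ) {u w : ℕ → Fin m → ℝ} {k : ℕ} (h : ∀ j < k, u j = w j) :
    sol G ξ u k = sol G ξ w k := by
  induction k with
  | zero => rfl
  | succ k ih => rw [sol, sol, ih fun j hj => h j (hj.trans k.lt_succ_self), h k k.lt_succ_self]

/-- The ISS estimate at time `k` for arbitrary inputs, in terms of the input before time `k`. -/
theorem sol_le_of_forall_lt {β : ℝ → ℝ → ℝ} {γ : ℝ → ℝ} (hγ : ClassK γ)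
    (hISS : ∀ (ξ : Fin n → ℝ) (u : ℕ → Fin m → ℝ), BoundedInput q u → ∀ k : ℕ,
      p (sol G ξ u k) ≤ β (p ξ) k + γ (supNorm q u))
    (ξ : Fin n → ℝ) (u : ℕ → Fin m → ℝ) (k : ℕ) {A : ℝ} (hA : 0 ≤ A)
    (hu : ∀ j < k, γ (q (u j)) ≤ A) : p (sol G ξ u k) ≤ β (p ξ) k + A := by
  -- Truncation leaves the state at time `k` unchanged and makes the input bounded, with its
  -- supremum attained.
  set w : ℕ → Fin m → ℝ := fun j => if j < k then u j else 0 with hw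
  obtain ⟨i, -, hi⟩ := Finset.exists_max_image (Finset.range (k + 1)) (fun j => q (w j))
    ⟨0, by simp⟩
  have hmax : ∀ j, q (w j) ≤ q (w i) := by
    intro j
    by_cases hj : j < k
    · exact hi j (Finset.mem_range.2 (hj.trans k.lt_succ_self))
    · have : w j = 0 := if_neg hj
      rw [this, map_zero]
      exact apply_nonneg q _
  have hbdd : BoundedInput q w := ⟨q (w i), by rintro _ ⟨j, rfl⟩; exact hmax j⟩
  have h0 : 0 ≤ supNorm q w := Real.iSup_nonneg fun j => apply_nonneg q _
  have hwi : γ (q (w i)) ≤ A := by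
    by_cases hik : i < k
    · rw [show w i = u i from if_pos hik]
      exact hu i hik
    · rw [show w i = 0 from if_neg hik, map_zero, hγ.map_zero]
      exact hA
  have hs : γ (supNorm q w) ≤ A := (hγ.mono h0 (ciSup_le hmax)).trans hwi
  rw [sol_congr ξ (fun j hj => (if_pos hj).symm : ∀ j < k, u j = w j)]
  linarith [hISS ξ w hbdd k]

/-- Exponential decay of the rescaled state with fading memory of the input. -/
theorem exp_mul_sol_le_max {β : ℝ → ℝ → ℝ} {γ ω : ℝ → ℝ} (hβ : ClassKL β) (hγ : ClassK γ)
    (hISS : ∀ (ξ : Fin n → ℝ) (u : ℕ → Fin m → ℝ), BoundedInput q u → ∀ k : ℕ,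
      p (sol G ξ u k) ≤ β (p ξ) k + γ (supNorm q u))
    (hω : ClassK ω)
    (hfast : ∀ r, 0 < r → ∃ T : ℕ, 2 * β (exp 1 * r) T < r ∧ exp T * ω r ≤ ω (exp 1 * r))
    (ξ : Fin n → ℝ) (u : ℕ → Fin m → ℝ) {c : ℝ} (hc : 0 ≤ c) (k : ℕ)
    (hu : ∀ j < k, exp j * ω (2 * exp 1 * γ (q (u j))) ≤ c) :
    exp k * ω (p (sol G ξ u k)) ≤ max (ω (2 * exp 1 * β (p ξ) 0 + p ξ)) c := by
  have he := Real.exp_pos 1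
  induction k using Nat.strong_induction_on with
  | _ k ih =>
  -- At a first violation `k`, the weighted state dominates its own past and the weighted inputs.
  by_contra! hlt
  set M := max (ω (2 * exp 1 * β (p ξ) 0 + p ξ)) c
  have hcM : c ≤ M := le_max_right _ _
  have hpast : ∀ j ≤ k, exp j * ω (p (sol G ξ u j)) ≤ exp k * ω (p (sol G ξ u k)) := by
    intro j hj
    rcases hj.eq_or_lt with rfl | hj
    · rfl
    · exact (ih j hj fun i hi => hu i (hi.trans hj)).trans hlt.le
  set r := p (sol G ξ u k) with hr
  have hr0 : 0 < r := by
    refine (apply_nonneg p _).lt_of_ne fun h => ?_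
    rw [← hr] at h
    rw [← h, hω.map_zero, mul_zero] at hlt
    linarith
  have hωr : 0 ≤ ω r := hω.nonneg hr0.le
  obtain ⟨T, hT, hTω⟩ := hfast r hr0
  have her : 0 ≤ exp 1 * r := (mul_pos he hr0).le
  have hinput : ∀ j < k, k ≤ j + T → γ (q (u j)) ≤ r / 2 := by
    intro j hj hjT
    have h1 : exp k ≤ exp j * exp T := by
      rw [← Real.exp_add, Real.exp_le_exp]
      exact_mod_cast hjT
    have h2 : exp j * ω (2 * exp 1 * γ (q (u j))) ≤ exp j * ω (exp 1 * r) :=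
      calc _ ≤ exp k * ω r := (hu j hj).trans (hcM.trans hlt.le)
        _ ≤ exp j * exp T * ω r := mul_le_mul_of_nonneg_right h1 hωr
        _ ≤ exp j * ω (exp 1 * r) := by
          rw [mul_assoc]
          exact mul_le_mul_of_nonneg_left hTω (Real.exp_pos _).le
    have h3 := hω.le_of_map_le (mul_nonneg (by positivity) (hγ.nonneg (apply_nonneg q _))) her
      (le_of_mul_le_mul_left h2 (Real.exp_pos _))
    have h4 : exp 1 * (2 * γ (q (u j))) ≤ exp 1 * r := by linarith
    linarith [le_of_mul_le_mul_left h4 he]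
  -- If `T ≤ k`, restart at `k - T`: the state there is at most `e * r`, so `r < r / 2 + r / 2`.
  -- Otherwise `r ≤ 2 * β (p ξ) 0`, and `e^k ≤ e^T` contradicts the violation.
  rcases le_total T k with hTk | hkT
  · have hx : exp (k - T : ℕ) * ω (p (sol G ξ u (k - T))) ≤
        exp (k - T : ℕ) * ω (exp 1 * r) := by
      refine (hpast _ (Nat.sub_le k T)).trans ?_
      have : exp (k : ℝ) = exp (k - T : ℕ) * exp T := by
        rw [← Real.exp_add, ← Nat.cast_add, Nat.sub_add_cancel hTk]
      rw [this, mul_assoc]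
      exact mul_le_mul_of_nonneg_left hTω (Real.exp_pos _).le
    have hx' := hω.le_of_map_le (apply_nonneg p _) her
      (le_of_mul_le_mul_left hx (Real.exp_pos _))
    have h1 := sol_le_of_forall_lt hγ hISS (sol G ξ u (k - T)) (fun j => u (k - T + j)) T
      (half_pos hr0).le fun j hj => hinput _ (by omega) (by omega)
    rw [← sol_add, Nat.sub_add_cancel hTk, ← hr] at h1
    have h2 := (hβ.classK T T.cast_nonneg).mono (apply_nonneg p _) hx'
    linarith
  · have h1 := sol_le_of_forall_lt hγ hISS ξ u k (half_pos hr0).le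
      fun j hj => hinput j hj (by omega)
    rw [← hr] at h1
    have h2 := hβ.anti (apply_nonneg p ξ) le_rfl (k.cast_nonneg (α := ℝ))
    have h3 : exp 1 * r ≤ exp 1 * (2 * β (p ξ) 0) :=
      mul_le_mul_of_nonneg_left (by linarith) he.le
    have h4 : ω (exp 1 * r) ≤ ω (2 * exp 1 * β (p ξ) 0 + p ξ) :=
      hω.mono her (by linarith [apply_nonneg p ξ])
    have h5 : exp k * ω r ≤ exp T * ω r :=
      mul_le_mul_of_nonneg_right (Real.exp_le_exp.2 (by exact_mod_cast hkT)) hωr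
    have h6 : ω (2 * exp 1 * β (p ξ) 0 + p ξ) ≤ M := le_max_left _ _
    linarith

/-! ### The Lyapunov function -/

theorem le_supNorm {u : ℕ → Fin m → ℝ} (hu : BoundedInput q u) (k : ℕ) :
    q (u k) ≤ supNorm q u :=
  le_ciSup hu k

/-- The values over which the Lyapunov function takes the supremum: the exponentially weighted
states reachable from `ξ`, discounted by the exponentially weighted input. -/
def lyapunovValues (p : Seminorm ℝ (Fin n → ℝ)) (q : Seminorm ℝ (Fin m → ℝ))
    (G : (Fin n → ℝ) → (Fin m → ℝ) → (Fin n → ℝ)) (ω χ : ℝ → ℝ) (ξ : Fin n → ℝ) : Set ℝ :=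
  {v | ∃ (k : ℕ) (u : ℕ → Fin m → ℝ) (c : ℝ), 0 ≤ c ∧ (∀ j < k, exp j * χ (q (u j)) ≤ c) ∧
    v = exp k * ω (p (sol G ξ u k)) - c}

theorem mem_lyapunovValues_self (ω χ : ℝ → ℝ) (ξ : Fin n → ℝ) :
    ω (p ξ) ∈ lyapunovValues p q G ω χ ξ :=
  ⟨0, 0, 0, le_rfl, fun j hj => absurd hj j.not_lt_zero, by simp [sol]⟩

/-- Prepend `v` to the input: every weight gains a factor `e`, and `e * c + χ (q v)` dominates both
the shifted inputs and the new one. -/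
theorem exists_mem_lyapunovValues_of_step {ω χ : ℝ → ℝ} (hχ : ∀ v, 0 ≤ χ (q v))
    {ξ : Fin n → ℝ} {v : Fin m → ℝ} {a : ℝ} (ha : a ∈ lyapunovValues p q G ω χ (G ξ v)) :
    exp 1 * a - χ (q v) ∈ lyapunovValues p q G ω χ ξ := by
  obtain ⟨k, u, c, hc, hu, rfl⟩ := ha
  have he := Real.exp_pos 1
  refine ⟨k + 1, fun j => Nat.casesOn j v u, exp 1 * c + χ (q v),
    add_nonneg (mul_nonneg he.le hc) (hχ v), ?_, ?_⟩
  · rintro (_ | j) hj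
    · simpa using mul_nonneg he.le hc
    · have h1 := mul_le_mul_of_nonneg_left (hu j (Nat.lt_of_succ_lt_succ hj)) he.le
      rw [← mul_assoc, ← Real.exp_add, add_comm] at h1
      push_cast
      linarith [hχ v]
  · rw [add_comm k 1, sol_add]
    have h1 : ∀ j, (fun i => Nat.casesOn i v u : ℕ → Fin m → ℝ) (1 + j) = u j := by
      intro j
      rw [add_comm]
    simp only [h1]
    push_cast
    rw [Real.exp_add]
    simp only [sol]
    ring

theorem ISS.exists_isMStepISSLyapunov_one (hG : ISS p q G) :
    ∃ V, IsMStepISSLyapunov p q G 1 V := by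
  obtain ⟨β, γ, hβ, hγ, hISS⟩ := hG
  obtain ⟨ω, hω, hfast⟩ := hβ.exists_classKInf_fast
  have he := Real.exp_pos 1
  have he1 : exp (-1) < 1 := by simp
  have hχ : ClassK (fun s => ω (2 * exp 1 * γ s)) :=
    hω.toClassK.comp (hγ.const_mul (by positivity))
  set χ : ℝ → ℝ := fun s => ω (2 * exp 1 * γ s)
  have hχ0 : ∀ v, 0 ≤ χ (q v) := fun v => hχ.nonneg (apply_nonneg q v)
  set S := lyapunovValues p q G ω χ
  have hub : ∀ ξ, ∀ a ∈ S ξ, a ≤ ω (2 * exp 1 * β (p ξ) 0 + p ξ) := by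
    rintro ξ _ ⟨k, u, c, hc, hu, rfl⟩
    have h1 := exp_mul_sol_le_max hβ hγ hISS hω.toClassK hfast ξ u hc k hu
    have h2 : 0 ≤ ω (2 * exp 1 * β (p ξ) 0 + p ξ) :=
      ((hβ.classK 0 le_rfl).const_mul (by positivity : 0 < 2 * exp 1)).add_id
        |> hω.toClassK.comp |>.nonneg (apply_nonneg p ξ)
    -- When the maximum is `c`, subtracting `c` leaves a value at most zero.
    rcases le_max_iff.1 h1 with h | h <;> linarith
  have hle : ∀ ξ, ∀ a ∈ S ξ, a ≤ sSup (S ξ) := fun ξ a ha => le_csSup ⟨_, hub ξ⟩ ha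
  have hmem : ∀ ξ, ω (p ξ) ∈ S ξ := mem_lyapunovValues_self ω χ
  refine ⟨fun ξ => sSup (S ξ), ⟨fun ξ => ?_, ω, fun s => ω (2 * exp 1 * β s 0 + s), hω,
    hω.comp_add_id ((hβ.classK 0 le_rfl).const_mul (by positivity)), fun ξ =>
      ⟨hle ξ _ (hmem ξ), csSup_le ⟨_, hmem ξ⟩ (hub ξ)⟩⟩,
    fun s => exp (-1) * χ s, fun s => exp (-1) * s, hχ.const_mul (Real.exp_pos _),
    ⟨by fun_prop, mul_zero _, fun s hs => mul_pos (Real.exp_pos _) hs⟩, ?_, fun ξ u hu => ?_⟩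
  · exact (hω.nonneg (apply_nonneg p ξ)).trans (hle ξ _ (hmem ξ))
  · have := classKInf_const_mul (sub_pos.2 he1)
    simpa only [sub_mul, one_mul] using this
  · refine csSup_le ⟨_, hmem _⟩ fun a ha => ?_
    have h1 := hle ξ _ (exists_mem_lyapunovValues_of_step hχ0 ha)
    have h2 : χ (q (u 0)) ≤ χ (supNorm q u) := hχ.mono (apply_nonneg q _) (le_supNorm hu 0)
    rw [← mul_add, Real.exp_neg, inv_mul_eq_div, le_div_iff₀' he]
    linarith

end Trajectories

end ISSys

theorem mainTheorem7 (n m : ℕ)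
    (p : Seminorm ℝ (Fin n → ℝ)) (hp : ∀ x, p x = 0 → x = 0)
    (q : Seminorm ℝ (Fin m → ℝ)) (hq : ∀ v, q v = 0 → v = 0)
    (G : (Fin n → ℝ) → (Fin m → ℝ) → (Fin n → ℝ))
    (hG : ISSys.ISS p q G) :
    ∃ V : (Fin n → ℝ) → ℝ,
      ISSys.IsFiniteStepISSLyapunov p q G V ∧ ISSys.IsMStepISSLyapunov p q G 1 V := by
  obtain ⟨V, hV⟩ := hG.exists_isMStepISSLyapunov_one
  exact ⟨V, ⟨1, hV⟩, hV⟩
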